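/- Let $K\subseteq\mathbb R^n$ be a compact set with nonempty interior, equipped with the Lebesgue measure. For a polynomial $f\in\mathbb R[x_1,\dots,x_n]$ let $f_{\min,K}=\min_{x\in K}f(x)$, and for $r\in\mathbb N$ let $$f^{(r)}_K=\inf\Big\{\int_K f(x)q(x)\,dx \;:\; q\in\Sigma_r,\ \int_K q(x)\,dx=1\Big\},\qquad E^{(r)}_K(f)=f^{(r)}_K-f_{\min,K},$$ where $\Sigma_r$ is the set of sums of squares of real polynomials that have degree at most $2r$. If $f$ has a global minimizer on $K$ that lies in the interior of $K$, then $E^{(r)}_K(f)=O(1/r^2)$, with the following control of the constants. Let $\widehat K\supseteq K$ be any compact convex set (for instance a hypercube containing $K$), put $\gamma_{\widehat K,f}=\tfrac12\max_{x\in\widehat K}\|\nabla^2 f(x)\|$ (spectral norm of the Hessian), and let $G\in\mathbb R$. There is a constant $c>0$, depending only on $K,\widehat K,G$, such that for every $a\in\operatorname{int}K$ there are a constant $C_a>0$ and an $r_a\in\mathbb N$, depending only on $K,\widehat K,G,a$, such that every polynomial $f$ with $f(a)=f_{\min,K}$ and $\gamma_{\widehat K,f}\le G$ satisfies $$E^{(r)}_K(f)\le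 \frac{C_a}{r^2}\ \text{ for all } r\ge 1,\qquad\text{and}\qquad E^{(r)}_K(f)\le \frac{c}{r^2}\ \text{ for all } r\ge r_a .$$ -/

import Mathlib

open MeasureTheory

namespace LasserreUpper

noncomputable section

/-- The real function on `ℝⁿ` (with its Euclidean structure) defined by an `n`-variate polynomial. -/
def polyFun {n : ℕ} (p : MvPolynomial (Fin n) ℝ) (x : EuclideanSpace ℝ (Fin n)) : ℝ :=
  MvPolynomial.eval (fun i => x i) p

/-- `f_{min,K}`, the minimum value of `f` on `K` (attained for `K` compact and nonempty). -/
def minValue {n : ℕ} (K : Set (EuclideanSpace ℝ (Fin n))) (f : MvPolynomial (Fin n) ℝ) : ℝ :=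
  sInf (polyFun f '' K)

/-- `Σ_r`, the sums of squares of polynomials that have degree at most `2r`. -/
def sosPolys (n r : ℕ) : Set (MvPolynomial (Fin n) ℝ) :=
  {q | IsSumSq q ∧ q.totalDegree ≤ 2 * r}

/-- The upper bound `f^{(r)}_{K,μ}`: the infimum of `∫_K f q dμ` over all `q ∈ Σ_r` with
`∫_K q dμ = 1`. -/
def upperBound {n : ℕ} (K : Set (EuclideanSpace ℝ (Fin n)))
    (μ : Measure (EuclideanSpace ℝ (Fin n))) (f : MvPolynomial (Fin n) ℝ) (r : ℕ) : ℝ :=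
  sInf {v | ∃ q ∈ sosPolys n r, ∫ x in K, polyFun q x ∂μ = 1 ∧
    v = ∫ x in K, polyFun f x * polyFun q x ∂μ}

/-- The error `E^{(r)}_{K,μ}(f) = f^{(r)}_{K,μ} - f_{min,K}`. -/
def upperError {n : ℕ} (K : Set (EuclideanSpace ℝ (Fin n)))
    (μ : Measure (EuclideanSpace ℝ (Fin n))) (f : MvPolynomial (Fin n) ℝ) (r : ℕ) : ℝ :=
  upperBound K μ f r - minValue K f

/-- `γ_{L,f} = ½ max_{x ∈ L} ‖∇²f(x)‖`. The operator norm of the second derivative, a symmetric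
bilinear form, is the spectral norm of the Hessian matrix. -/
def hessConst {n : ℕ} (L : Set (EuclideanSpace ℝ (Fin n))) (f : MvPolynomial (Fin n) ℝ) : ℝ :=
  (1 / 2) * sSup ((fun x => ‖fderiv ℝ (fderiv ℝ (polyFun f)) x‖) '' L)

end

end LasserreUpper

namespace LasserreUpper

/-! An interior minimizer `a` has zero gradient, so the Hessian bound gives `f x - f a ≤ 2 * G * ‖x
- a‖ ^ 2` on `K` (`polyFun_sub_le_of_hessConst_le`). It remains to find a sum of squares of degree
`O(k)` whose second moment about `a` is `O(1/k²)` times its mass (`upperError_le`). Take a fixed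
even power of the Fejér kernel at `s = ‖x - a‖² / R²`. Being at most `2 / (1 + k² s)`, it has second
moment `O((R/k)^(n+2))`; being at least `1/4` for `s ≤ 1/k²`, it has mass of order at least
`(R/k)^n` as soon as the ball of radius `R/k` about `a` lies in `K`. Only this threshold on `k`
depends on `a`, hence a uniform `c` for large `r`; for small `r` the constant density suffices. -/

open Polynomial in
/-- The Fejér kernel of order `k`, as a polynomial in `s = sin² θ`:
its value at `s` is `(sin (k θ) / (k sin θ))²`. -/
noncomputable def fejerKernel (k : ℕ) : ℝ[X] :=
  C (1 / (2 * (k : ℝ) ^ 2)) * (1 - (Chebyshev.T ℝ k).comp (1 - 2 * X)).divX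

theorem natDegree_fejerKernel_le (k : ℕ) : (fejerKernel k).natDegree ≤ k := by
  refine (Polynomial.natDegree_C_mul_le _ _).trans (Polynomial.natDegree_divX_le.trans ?_)
  refine (Polynomial.natDegree_sub_le _ _).trans (max_le (by simp) ?_)
  refine Polynomial.natDegree_comp_le.trans ?_
  have h : (1 - 2 * Polynomial.X : Polynomial ℝ).natDegree ≤ 1 := by compute_degree
  calc _ ≤ (Polynomial.Chebyshev.T ℝ k).natDegree * 1 := Nat.mul_le_mul_left _ h
    _ = k := by rw [Polynomial.Chebyshev.natDegree_T]; simp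

/-- With `1 - 2 sin² θ = cos 2θ`, `1 - T_k (cos 2θ) = 1 - cos 2kθ = 2 sin² kθ`; since `T_k 1 = 1`,
`divX` is an exact division. -/
theorem fejerKernel_eval_sin_sq {k : ℕ} (hk : 1 ≤ k) (θ : ℝ) :
    (k : ℝ) ^ 2 * (Real.sin θ ^ 2 * (fejerKernel k).eval (Real.sin θ ^ 2)) =
      Real.sin (k * θ) ^ 2 := by
  have hk' : (0 : ℝ) < k := by exact_mod_cast hk
  have h0 : (1 - (Polynomial.Chebyshev.T ℝ k).comp (1 - 2 * Polynomial.X)).coeff 0 = 0 := by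
    rw [Polynomial.coeff_zero_eq_eval_zero]
    simp
  have h1 := Polynomial.X_mul_divX_add
    (1 - (Polynomial.Chebyshev.T ℝ k).comp (1 - 2 * Polynomial.X))
  rw [h0, Polynomial.C_0, add_zero] at h1
  have h2 := congrArg (Polynomial.eval (Real.sin θ ^ 2)) h1
  have h3 : 1 - 2 * Real.sin θ ^ 2 = Real.cos (2 * θ) := by
    rw [Real.cos_two_mul, Real.cos_sq']; ring
  have h4 : ((k : ℤ) : ℝ) * (2 * θ) = 2 * (k * θ) := by push_cast; ring
  simp only [Polynomial.eval_mul, Polynomial.eval_X, Polynomial.eval_sub, Polynomial.eval_one,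
    Polynomial.eval_comp, Polynomial.eval_ofNat, h3, Polynomial.Chebyshev.T_real_cos, h4] at h2
  rw [Real.cos_two_mul, Real.cos_sq'] at h2
  simp only [fejerKernel, Polynomial.eval_mul, Polynomial.eval_C]
  field_simp
  linarith

theorem abs_sin_nat_mul_le (k : ℕ) (θ : ℝ) : |Real.sin (k * θ)| ≤ k * |Real.sin θ| := by
  induction k with
  | zero => simp
  | succ k ih =>
    push_cast
    rw [add_mul, one_mul, Real.sin_add]
    calc _ ≤ |Real.sin (k * θ)| * |Real.cos θ| + |Real.cos (k * θ)| * |Real.sin θ| := by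
          rw [← abs_mul, ← abs_mul]; exact abs_add_le _ _
      _ ≤ |Real.sin (k * θ)| * 1 + 1 * |Real.sin θ| := by
          gcongr <;> exact Real.abs_cos_le_one _
      _ ≤ _ := by linarith

/-- A closed condition on `[0, 1]` that holds at `sin² θ` for `θ ∈ (0, π/2]` holds throughout. -/
theorem forall_Icc_of_forall_sin_sq {P : ℝ → Prop} (hP : IsClosed {s | P s}) {δ : ℝ} (hδ : 0 < δ)
    (hδ1 : δ ≤ 1)
    (h : ∀ θ, 0 < θ → θ ≤ Real.pi / 2 → Real.sin θ ^ 2 ≤ δ → P (Real.sin θ ^ 2)) :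
    ∀ s ∈ Set.Icc 0 δ, P s := by
  have h1 : Set.Ioc 0 δ ⊆ {s | P s} := by
    rintro s ⟨hs0, hs1⟩
    have h2 : Real.sqrt s ≤ 1 := Real.sqrt_le_one.mpr (hs1.trans hδ1)
    have h3 : Real.sin (Real.arcsin (Real.sqrt s)) ^ 2 = s := by
      rw [Real.sin_arcsin (by linarith [Real.sqrt_nonneg s]) h2, Real.sq_sqrt hs0.le]
    have := h (Real.arcsin (Real.sqrt s)) (Real.arcsin_pos.mpr (Real.sqrt_pos.mpr hs0))
      (Real.arcsin_le_pi_div_two _) (by rw [h3]; exact hs1)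
    rwa [h3] at this
  -- The closure recovers `s = 0`, where the trigonometric identity degenerates to `0 = 0`.
  have := closure_minimal h1 hP
  rw [closure_Ioc hδ.ne] at this
  exact this

theorem fejerKernel_nonneg {k : ℕ} (hk : 1 ≤ k) :
    ∀ s ∈ Set.Icc (0 : ℝ) 1, 0 ≤ (fejerKernel k).eval s := by
  have hk' : (0 : ℝ) < k := by exact_mod_cast hk
  refine forall_Icc_of_forall_sin_sq (isClosed_le continuous_const (Polynomial.continuous _))
    one_pos le_rfl fun θ h0 h1 _ => ?_
  have hs : 0 < Real.sin θ := Real.sin_pos_of_pos_of_lt_pi h0 (by linarith [Real.pi_pos])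
  have h := fejerKernel_eval_sin_sq hk θ
  rw [← mul_assoc] at h
  have h2 : 0 < (k : ℝ) ^ 2 * Real.sin θ ^ 2 := by positivity
  exact nonneg_of_mul_nonneg_right (h ▸ sq_nonneg _) h2

theorem fejerKernel_le_one {k : ℕ} (hk : 1 ≤ k) :
    ∀ s ∈ Set.Icc (0 : ℝ) 1, (fejerKernel k).eval s ≤ 1 := by
  have hk' : (0 : ℝ) < k := by exact_mod_cast hk
  refine forall_Icc_of_forall_sin_sq (isClosed_le (Polynomial.continuous _) continuous_const)
    one_pos le_rfl fun θ h0 h1 _ => ?_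
  have hs : 0 < Real.sin θ := Real.sin_pos_of_pos_of_lt_pi h0 (by linarith [Real.pi_pos])
  have h := fejerKernel_eval_sin_sq hk θ
  rw [← mul_assoc] at h
  have h2 : 0 < (k : ℝ) ^ 2 * Real.sin θ ^ 2 := by positivity
  refine le_of_mul_le_mul_left ?_ h2
  rw [h, mul_one, ← mul_pow, sq_le_sq, abs_mul, abs_of_pos hk']
  exact abs_sin_nat_mul_le k θ

theorem mul_fejerKernel_le_one {k : ℕ} (hk : 1 ≤ k) :
    ∀ s ∈ Set.Icc (0 : ℝ) 1, (k : ℝ) ^ 2 * (s * (fejerKernel k).eval s) ≤ 1 := by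
  refine forall_Icc_of_forall_sin_sq (isClosed_le
    (continuous_const.mul (continuous_id.mul (Polynomial.continuous _))) continuous_const)
    one_pos le_rfl fun θ h0 h1 _ => ?_
  exact (fejerKernel_eval_sin_sq hk θ).trans_le (Real.sin_sq_le_one _)

/-- Jordan's inequality twice: `k sin θ ≤ 1` forces `kθ ≤ π/2`, and then `sin kθ ≥ (2/π) kθ ≥ (1/2)
k sin θ`. -/
theorem le_fejerKernel {k : ℕ} (hk : 1 ≤ k) :
    ∀ s ∈ Set.Icc (0 : ℝ) (1 / (k : ℝ) ^ 2), 1 / 4 ≤ (fejerKernel k).eval s := by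
  have hk' : (0 : ℝ) < k := by exact_mod_cast hk
  have hk1 : (1 : ℝ) ≤ k := by exact_mod_cast hk
  refine forall_Icc_of_forall_sin_sq (isClosed_le continuous_const (Polynomial.continuous _))
    (by positivity) (by rw [div_le_one (by positivity)]; exact one_le_pow₀ hk1)
    fun θ h0 h1 h3 => ?_
  have hpi := Real.pi_pos
  have hs : 0 < Real.sin θ := Real.sin_pos_of_pos_of_lt_pi h0 (by linarith)
  have h := fejerKernel_eval_sin_sq hk θ
  rw [← mul_assoc] at h
  have h2 : 0 < (k : ℝ) ^ 2 * Real.sin θ ^ 2 := by positivity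
  have h4 : k * Real.sin θ ≤ 1 := by
    rw [le_div_iff₀ (by positivity)] at h3
    nlinarith [mul_pos hk' hs]
  have h5 := Real.mul_le_sin h0.le h1
  have h6 : k * θ ≤ Real.pi / 2 := by
    have : 2 / Real.pi * (k * θ) ≤ 1 := by nlinarith
    rw [div_mul_eq_mul_div, div_le_one hpi] at this
    linarith
  have h7 := Real.mul_le_sin (by positivity : 0 ≤ k * θ) h6
  have h8 : (1 / 2 : ℝ) ≤ 2 / Real.pi := by
    rw [div_le_div_iff₀ two_pos hpi]; linarith [Real.pi_le_four]
  have h9 : 1 / 2 * (k * Real.sin θ) ≤ Real.sin (k * θ) :=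
    calc 1 / 2 * (k * Real.sin θ) ≤ 2 / Real.pi * (k * θ) := by
          gcongr; exact (Real.sin_lt h0).le
      _ ≤ _ := h7
  refine le_of_mul_le_mul_left ?_ h2
  rw [h]
  calc _ = (1 / 2 * (k * Real.sin θ)) ^ 2 := by ring
    _ ≤ _ := by gcongr

theorem fejerKernel_le_two_div {k : ℕ} (hk : 1 ≤ k) {s : ℝ} (hs : s ∈ Set.Icc (0 : ℝ) 1) :
    (fejerKernel k).eval s ≤ 2 / (1 + k ^ 2 * s) := by
  have hs0 := hs.1
  rw [le_div_iff₀ (by positivity)]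
  linarith [fejerKernel_le_one hk s hs, mul_fejerKernel_le_one hk s hs]

/-! ### Polynomials as functions -/

theorem polyFun_mul {n : ℕ} (p q : MvPolynomial (Fin n) ℝ) (x : EuclideanSpace ℝ (Fin n)) :
    polyFun (p * q) x = polyFun p x * polyFun q x := by simp [polyFun]

theorem polyFun_pow {n : ℕ} (p : MvPolynomial (Fin n) ℝ) (m : ℕ)
    (x : EuclideanSpace ℝ (Fin n)) : polyFun (p ^ m) x = polyFun p x ^ m := by simp [polyFun]

theorem polyFun_C {n : ℕ} (c : ℝ) (x : EuclideanSpace ℝ (Fin n)) :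
    polyFun (MvPolynomial.C c) x = c := by simp [polyFun]

theorem polyFun_aeval {n : ℕ} (p : MvPolynomial (Fin n) ℝ) (F : Polynomial ℝ)
    (x : EuclideanSpace ℝ (Fin n)) : polyFun (Polynomial.aeval p F) x = F.eval (polyFun p x) := by
  induction F using Polynomial.induction_on' with
  | add F H hF hH => simp only [map_add, Polynomial.eval_add, ← hF, ← hH]; simp [polyFun]
  | monomial m c => simp [polyFun, Polynomial.aeval_monomial, MvPolynomial.algebraMap_eq]

theorem totalDegree_aeval_le {n : ℕ} (p : MvPolynomial (Fin n) ℝ) (F : Polynomial ℝ) :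
    (Polynomial.aeval p F).totalDegree ≤ F.natDegree * p.totalDegree := by
  rw [Polynomial.aeval_eq_sum_range]
  refine MvPolynomial.totalDegree_finsetSum_le fun i hi => ?_
  refine (MvPolynomial.totalDegree_smul_le _ _).trans
    ((MvPolynomial.totalDegree_pow _ _).trans ?_)
  exact Nat.mul_le_mul_right _ (Nat.lt_succ_iff.mp (Finset.mem_range.mp hi))

theorem contDiff_polyFun {n : ℕ} (p : MvPolynomial (Fin n) ℝ) {m : WithTop ℕ∞} :
    ContDiff ℝ m (polyFun p) := by
  induction p using MvPolynomial.induction_on with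
  | C a => simpa only [funext fun x => polyFun_C a x] using contDiff_const
  | add p q hp hq =>
    have : polyFun (p + q) = fun x => polyFun p x + polyFun q x := by
      funext x; simp [polyFun]
    rw [this]; exact hp.add hq
  | mul_X p i hp =>
    have : polyFun (p * MvPolynomial.X i) = fun x => polyFun p x * x i := by
      funext x; simp [polyFun]
    rw [this]
    exact hp.mul (by fun_prop)

theorem continuous_polyFun {n : ℕ} (p : MvPolynomial (Fin n) ℝ) : Continuous (polyFun p) :=
  (contDiff_polyFun p (m := 0)).continuous

theorem polyFun_nonneg_of_isSumSq {n : ℕ} {q : MvPolynomial (Fin n) ℝ} (hq : IsSumSq q)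
    (x : EuclideanSpace ℝ (Fin n)) : 0 ≤ polyFun q x := by
  induction hq with
  | zero => simp [polyFun]
  | sq_add a _ ih =>
    simp only [polyFun, map_add, map_mul] at ih ⊢
    exact add_nonneg (mul_self_nonneg _) ih

/-! ### Reduction to a second moment -/

/-- Bounding the error by testing with an unnormalised sum of squares. -/
theorem upperError_le {n : ℕ} {K : Set (EuclideanSpace ℝ (Fin n))} (hK : IsCompact K)
    {a : EuclideanSpace ℝ (Fin n)} (ha : a ∈ K) {f : MvPolynomial (Fin n) ℝ}
    (hmin : ∀ x ∈ K, polyFun f a ≤ polyFun f x) {A : ℝ} (hA : 0 ≤ A)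
    (hquad : ∀ x ∈ K, polyFun f x - polyFun f a ≤ A * ‖x - a‖ ^ 2) {r : ℕ}
    {q : MvPolynomial (Fin n) ℝ} (hq : q ∈ sosPolys n r) (hpos : 0 < ∫ x in K, polyFun q x) {B : ℝ}
    (hB : ∫ x in K, ‖x - a‖ ^ 2 * polyFun q x ≤ B * ∫ x in K, polyFun q x) :
    upperError K volume f r ≤ A * B := by
  have hKm := hK.measurableSet
  have hint : ∀ g : EuclideanSpace ℝ (Fin n) → ℝ, Continuous g → IntegrableOn g K :=
    fun g hg => hg.continuousOn.integrableOn_compact hK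
  have hminv : minValue K f = polyFun f a :=
    IsLeast.csInf_eq ⟨⟨a, ha, rfl⟩, by rintro _ ⟨x, hx, rfl⟩; exact hmin x hx⟩
  set m := ∫ x in K, polyFun q x with hm
  have hbdd : BddBelow {v | ∃ q ∈ sosPolys n r, ∫ x in K, polyFun q x = 1 ∧
      v = ∫ x in K, polyFun f x * polyFun q x} := by
    refine ⟨polyFun f a, ?_⟩
    rintro _ ⟨p, hp, hp1, rfl⟩
    calc polyFun f a = ∫ x in K, polyFun f a * polyFun p x := by
          rw [integral_const_mul, hp1, mul_one]
      _ ≤ _ := setIntegral_mono_on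
          (hint _ (continuous_const.mul (continuous_polyFun p)))
          (hint _ ((continuous_polyFun f).mul (continuous_polyFun p))) hKm fun x hx =>
          mul_le_mul_of_nonneg_right (hmin x hx) (polyFun_nonneg_of_isSumSq hp.1 x)
  have hle : upperBound K volume f r ≤ ∫ x in K, polyFun f x * (m⁻¹ * polyFun q x) := by
    refine csInf_le hbdd ⟨MvPolynomial.C m⁻¹ * q, ⟨?_, ?_⟩, ?_, ?_⟩
    · refine IsSumSq.mul ?_ hq.1
      rw [← Real.mul_self_sqrt (inv_nonneg.mpr hpos.le), MvPolynomial.C_mul]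
      exact IsSumSq.mul_self _
    · refine (MvPolynomial.totalDegree_mul _ _).trans ?_
      rw [MvPolynomial.totalDegree_C, zero_add]
      exact hq.2
    · simp only [polyFun_mul, polyFun_C]
      rw [integral_const_mul, ← hm, inv_mul_cancel₀ hpos.ne']
    · simp only [polyFun_mul, polyFun_C]
  have hcq := continuous_polyFun q
  have hle2 : ∫ x in K, polyFun f x * (m⁻¹ * polyFun q x) ≤ polyFun f a + A * B :=
    calc _ ≤ ∫ x in K, (polyFun f a * m⁻¹ * polyFun q x
            + A * m⁻¹ * (‖x - a‖ ^ 2 * polyFun q x)) := by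
          refine setIntegral_mono_on (hint _ ?_) (hint _ ?_) hKm fun x hx => ?_
          · exact (continuous_polyFun f).mul (continuous_const.mul hcq)
          · fun_prop
          · have h1 := polyFun_nonneg_of_isSumSq hq.1 x
            have h2 : 0 ≤ m⁻¹ * polyFun q x := mul_nonneg (inv_nonneg.mpr hpos.le) h1
            nlinarith [mul_le_mul_of_nonneg_right (hquad x hx) h2]
      _ = polyFun f a + A * (m⁻¹ * ∫ x in K, ‖x - a‖ ^ 2 * polyFun q x) := by
          rw [integral_add (hint _ (by fun_prop)) (hint _ (by fun_prop)), integral_const_mul,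
            integral_const_mul, ← hm]
          field_simp
      _ ≤ polyFun f a + A * (m⁻¹ * (B * m)) := by gcongr
      _ = _ := by field_simp
  rw [upperError, hminv]
  linarith

/-- The quadratic upper estimate at an interior minimizer. -/
theorem polyFun_sub_le_of_hessConst_le {n : ℕ} {K L : Set (EuclideanSpace ℝ (Fin n))}
    (hL : IsCompact L) (hLconv : Convex ℝ L) (hKL : K ⊆ L) {G : ℝ}
    {a : EuclideanSpace ℝ (Fin n)} (ha : a ∈ interior K) {f : MvPolynomial (Fin n) ℝ}
    (hmin : ∀ x ∈ K, polyFun f a ≤ polyFun f x) (hG : hessConst L f ≤ G) :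
    0 ≤ G ∧ ∀ x ∈ K, polyFun f x - polyFun f a ≤ 2 * G * ‖x - a‖ ^ 2 := by
  have haK := interior_subset ha
  have hd : Differentiable ℝ (polyFun f) := (contDiff_polyFun f (m := 1)).differentiable one_ne_zero
  have hc1 : ContDiff ℝ 1 (fderiv ℝ (polyFun f)) :=
    (contDiff_polyFun f (m := 2)).fderiv_right (by norm_num)
  have hd2 : Differentiable ℝ (fderiv ℝ (polyFun f)) := hc1.differentiable one_ne_zero
  have hcont : Continuous fun x => ‖fderiv ℝ (fderiv ℝ (polyFun f)) x‖ :=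
    (hc1.continuous_fderiv one_ne_zero).norm
  have hbd : ∀ x ∈ L, ‖fderiv ℝ (fderiv ℝ (polyFun f)) x‖ ≤ 2 * G := fun x hx => by
    have := le_csSup (hL.image hcont).bddAbove ⟨x, hx, rfl⟩
    simp only [hessConst] at hG
    linarith
  -- The only use of interiority here: the gradient vanishes.
  have h0 : fderiv ℝ (polyFun f) a = 0 :=
    IsLocalMin.fderiv_eq_zero <| by
      filter_upwards [mem_interior_iff_mem_nhds.mp ha] with x hx using hmin x hx
  have hG0 : 0 ≤ 2 * G := (ContinuousLinearMap.opNorm_nonneg _).trans (hbd a (hKL haK))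
  refine ⟨by linarith, fun x hx => ?_⟩
  have haL := hKL haK
  have hseg : segment ℝ a x ⊆ L := hLconv.segment_subset haL (hKL hx)
  -- Two mean value estimates replace Taylor's formula, at the cost of a factor 2. Segments stay in
  -- the convex `L`, so `K` need not be convex.
  have h1 : ∀ y ∈ segment ℝ a x, ‖fderiv ℝ (polyFun f) y‖ ≤ 2 * G * ‖x - a‖ := fun y hy => by
    have := hLconv.norm_image_sub_le_of_norm_fderiv_le (fun z _ => hd2 z) hbd haL (hseg hy)
    rw [h0, sub_zero] at this
    refine this.trans (mul_le_mul_of_nonneg_left ?_ hG0)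
    obtain ⟨t, ht, rfl⟩ := (segment_eq_image' ℝ a x ▸ hy)
    simp only [add_sub_cancel_left, norm_smul, Real.norm_eq_abs, abs_of_nonneg ht.1]
    exact mul_le_of_le_one_left (norm_nonneg _) ht.2
  have h2 := (convex_segment a x).norm_image_sub_le_of_norm_fderiv_le (fun z _ => hd z) h1
    (left_mem_segment ℝ a x) (right_mem_segment ℝ a x)
  calc _ ≤ ‖polyFun f x - polyFun f a‖ := Real.le_norm_self _
    _ ≤ _ := h2
    _ = _ := by ring

/-! ### The concentrated density and its moments -/

/-- The polynomial `‖x - a‖² / R²`. -/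
noncomputable def scaledSqDist {n : ℕ} (a : EuclideanSpace ℝ (Fin n)) (R : ℝ) :
    MvPolynomial (Fin n) ℝ :=
  MvPolynomial.C (1 / R ^ 2) * ∑ i, (MvPolynomial.X i - MvPolynomial.C (a i)) ^ 2

theorem polyFun_scaledSqDist {n : ℕ} (a x : EuclideanSpace ℝ (Fin n)) (R : ℝ) :
    polyFun (scaledSqDist a R) x = ‖x - a‖ ^ 2 / R ^ 2 := by
  rw [EuclideanSpace.real_norm_sq_eq]
  simp [polyFun, scaledSqDist]
  ring

theorem totalDegree_scaledSqDist_le {n : ℕ} (a : EuclideanSpace ℝ (Fin n)) (R : ℝ) :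
    (scaledSqDist a R).totalDegree ≤ 2 := by
  refine (MvPolynomial.totalDegree_mul _ _).trans ?_
  rw [MvPolynomial.totalDegree_C, zero_add]
  refine MvPolynomial.totalDegree_finsetSum_le fun i _ => ?_
  refine (MvPolynomial.totalDegree_pow _ _).trans ?_
  have : (MvPolynomial.X i - MvPolynomial.C (a i) : MvPolynomial (Fin n) ℝ).totalDegree ≤ 1 :=
    (MvPolynomial.totalDegree_sub _ _).trans (by simp)
  omega

/-- A sum of squares concentrated near `a` at scale `R / k`. -/
noncomputable def needle {n : ℕ} (a : EuclideanSpace ℝ (Fin n)) (R : ℝ) (k : ℕ) :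
    MvPolynomial (Fin n) ℝ :=
  Polynomial.aeval (scaledSqDist a R) (fejerKernel k) ^ (n + 1) *
    Polynomial.aeval (scaledSqDist a R) (fejerKernel k) ^ (n + 1)

theorem polyFun_needle {n : ℕ} (a x : EuclideanSpace ℝ (Fin n)) (R : ℝ) (k : ℕ) :
    polyFun (needle a R k) x = (fejerKernel k).eval (‖x - a‖ ^ 2 / R ^ 2) ^ (2 * n + 2) := by
  rw [needle, polyFun_mul, polyFun_pow, polyFun_aeval, polyFun_scaledSqDist]
  ring

theorem totalDegree_needle_le {n : ℕ} (a : EuclideanSpace ℝ (Fin n)) (R : ℝ) (k : ℕ) :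
    (needle a R k).totalDegree ≤ 2 * (2 * (n + 1) * k) := by
  have h1 : (Polynomial.aeval (scaledSqDist a R) (fejerKernel k)).totalDegree ≤ k * 2 :=
    (totalDegree_aeval_le _ _).trans
      (Nat.mul_le_mul (natDegree_fejerKernel_le k) (totalDegree_scaledSqDist_le a R))
  have h2 := (MvPolynomial.totalDegree_pow
    (Polynomial.aeval (scaledSqDist a R) (fejerKernel k)) (n + 1)).trans
      (Nat.mul_le_mul_left (n + 1) h1)
  refine (MvPolynomial.totalDegree_mul _ _).trans ((add_le_add h2 h2).trans (le_of_eq ?_))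
  ring

/-- The majorant has exponent `2n + 2`; one factor is spent on absorbing `‖y‖²`, and the remaining
decay of order `4n + 2` exceeds `n`. -/
theorem integrable_inv_one_add_norm_sq_pow (n : ℕ) :
    Integrable (fun y : EuclideanSpace ℝ (Fin n) => ((1 + ‖y‖ ^ 2) ^ (2 * n + 1))⁻¹) := by
  have h := integrable_rpow_neg_one_add_norm_sq (E := EuclideanSpace ℝ (Fin n))
    (μ := volume) (r := 2 * ((2 * n + 1 : ℕ) : ℝ)) (by
      rw [finrank_euclideanSpace_fin]; push_cast; linarith [(Nat.cast_nonneg n : (0 : ℝ) ≤ n)])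
  refine h.congr (Filter.Eventually.of_forall fun y => ?_)
  have h1 : -(2 * ((2 * n + 1 : ℕ) : ℝ)) / 2 = -((2 * n + 1 : ℕ) : ℝ) := by ring
  simp only [h1]
  rw [Real.rpow_neg (by positivity), Real.rpow_natCast]

theorem integral_norm_sq_mul_needle_le {n : ℕ} {K : Set (EuclideanSpace ℝ (Fin n))}
    (hK : IsCompact K) {a : EuclideanSpace ℝ (Fin n)} {R : ℝ} (hR : 0 < R)
    (hKR : ∀ x ∈ K, ‖x - a‖ ≤ R) {k : ℕ} (hk : 1 ≤ k) :
    ∫ x in K, ‖x - a‖ ^ 2 * polyFun (needle a R k) x ≤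
      (R / k) ^ (n + 2) * 2 ^ (2 * n + 2) *
        ∫ y : EuclideanSpace ℝ (Fin n), ((1 + ‖y‖ ^ 2) ^ (2 * n + 1))⁻¹ := by
  have hk' : (0 : ℝ) < k := by exact_mod_cast hk
  have hkR : 0 < (k : ℝ) / R := by positivity
  set g : EuclideanSpace ℝ (Fin n) → ℝ := fun y => ((1 + ‖y‖ ^ 2) ^ (2 * n + 1))⁻¹ with hg
  have hgi : Integrable g := integrable_inv_one_add_norm_sq_pow n
  have hgi2 : Integrable fun x => g (((k : ℝ) / R) • (x - a)) :=
    ((integrable_comp_smul_iff volume g hkR.ne').mpr hgi).comp_sub_right a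
  have hpt : ∀ x ∈ K, ‖x - a‖ ^ 2 * polyFun (needle a R k) x ≤
      (R / k) ^ 2 * 2 ^ (2 * n + 2) * g (((k : ℝ) / R) • (x - a)) := by
    intro x hx
    have hs : ‖x - a‖ ^ 2 / R ^ 2 ∈ Set.Icc (0 : ℝ) 1 :=
      ⟨by positivity, (div_le_one (by positivity)).mpr
        (pow_le_pow_left₀ (norm_nonneg _) (hKR x hx) 2)⟩
    have h1 := fejerKernel_le_two_div hk hs
    have h0 := fejerKernel_nonneg hk _ hs
    rw [polyFun_needle]
    simp only [hg, norm_smul, Real.norm_eq_abs, abs_of_pos hkR]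
    set t := (k / R * ‖x - a‖) ^ 2 with ht
    have ht1 : (k : ℝ) ^ 2 * (‖x - a‖ ^ 2 / R ^ 2) = t := by rw [ht]; ring
    have ht2 : ‖x - a‖ ^ 2 = (R / k) ^ 2 * t := by rw [ht]; field_simp
    have ht0 : 0 ≤ t := sq_nonneg _
    rw [ht1] at h1
    calc _ ≤ ‖x - a‖ ^ 2 * (2 / (1 + t)) ^ (2 * n + 2) := by gcongr
      _ = (R / k) ^ 2 * 2 ^ (2 * n + 2) * (t / (1 + t) * ((1 + t) ^ (2 * n + 1))⁻¹) := by
          rw [ht2, div_pow 2 (1 + t), show 2 * n + 2 = 2 * n + 1 + 1 from rfl,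
            pow_succ (1 + t) (2 * n + 1)]
          field_simp
      _ ≤ (R / k) ^ 2 * 2 ^ (2 * n + 2) * (1 * ((1 + t) ^ (2 * n + 1))⁻¹) := by
          gcongr
          rw [div_le_one (by positivity)]
          linarith
      _ = _ := by rw [one_mul]
  calc _ ≤ ∫ x in K, (R / k) ^ 2 * 2 ^ (2 * n + 2) * g (((k : ℝ) / R) • (x - a)) := by
        refine setIntegral_mono_on (ContinuousOn.integrableOn_compact hK ?_)
          (hgi2.const_mul _).integrableOn hK.measurableSet hpt
        have := continuous_polyFun (needle a R k)
        exact Continuous.continuousOn (by fun_prop)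
    _ = (R / k) ^ 2 * 2 ^ (2 * n + 2) * ∫ x in K, g (((k : ℝ) / R) • (x - a)) :=
        integral_const_mul _ _
    -- Passing to the whole space removes the dependence on the position of `a`.
    _ ≤ (R / k) ^ 2 * 2 ^ (2 * n + 2) * ∫ x, g (((k : ℝ) / R) • (x - a)) := by
        refine mul_le_mul_of_nonneg_left (setIntegral_le_integral hgi2 ?_) (by positivity)
        exact Filter.Eventually.of_forall fun x => by simp only [hg, Pi.zero_apply]; positivity
    _ = (R / k) ^ 2 * 2 ^ (2 * n + 2) * (((k / R) ^ n)⁻¹ * ∫ y, g y) := by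
        rw [integral_sub_right_eq_self (fun x => g (((k : ℝ) / R) • x)) a,
          Measure.integral_comp_smul_of_nonneg volume g _ (hR := hkR.le),
          finrank_euclideanSpace_fin, smul_eq_mul]
    _ = _ := by
        rw [← inv_pow, inv_div]
        ring

theorem le_integral_needle {n : ℕ} {K : Set (EuclideanSpace ℝ (Fin n))}
    (hK : IsCompact K) {a : EuclideanSpace ℝ (Fin n)} {R : ℝ} (hR : 0 < R) {k : ℕ} (hk : 1 ≤ k)
    (hball : Metric.ball a (R / k) ⊆ K) :
    (1 / 4) ^ (2 * n + 2) * ((R / k) ^ n *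
      volume.real (Metric.ball (0 : EuclideanSpace ℝ (Fin n)) 1)) ≤
      ∫ x in K, polyFun (needle a R k) x := by
  have hk' : (0 : ℝ) < k := by exact_mod_cast hk
  have hint : IntegrableOn (polyFun (needle a R k)) K :=
    (continuous_polyFun _).continuousOn.integrableOn_compact hK
  have hnn : ∀ x, 0 ≤ polyFun (needle a R k) x :=
    polyFun_nonneg_of_isSumSq (IsSumSq.mul_self _)
  calc _ = ∫ _ in Metric.ball a (R / k), (1 / 4 : ℝ) ^ (2 * n + 2) := by
        rw [setIntegral_const, smul_eq_mul, mul_comm, measureReal_def volume (Metric.ball a _),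
          Measure.addHaar_ball_of_pos volume a (by positivity), ENNReal.toReal_mul,
          ENNReal.toReal_ofReal (by positivity), finrank_euclideanSpace_fin, measureReal_def]
    _ ≤ ∫ x in Metric.ball a (R / k), polyFun (needle a R k) x := by
        refine setIntegral_mono_on (integrableOn_const measure_ball_lt_top.ne) (hint.mono_set hball)
          measurableSet_ball fun x hx => ?_
        rw [polyFun_needle]
        refine pow_le_pow_left₀ (by norm_num) (le_fejerKernel hk _ ⟨by positivity, ?_⟩) _
        rw [Metric.mem_ball, dist_eq_norm] at hx
        calc ‖x - a‖ ^ 2 / R ^ 2 ≤ (R / k) ^ 2 / R ^ 2 := by gcongr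
          _ = _ := by field_simp
    _ ≤ _ := setIntegral_mono_set hint (Filter.Eventually.of_forall hnn) hball.eventuallyLE

end LasserreUpper

/-! ### Choice of constants and conclusion -/

open LasserreUpper in
theorem mainTheorem3 (n : ℕ) (K L : Set (EuclideanSpace ℝ (Fin n)))
    (hK : IsCompact K) (hKint : (interior K).Nonempty)
    (hL : IsCompact L) (hLconv : Convex ℝ L) (hKL : K ⊆ L) (G : ℝ) :
    ∃ c : ℝ, 0 < c ∧ ∀ a ∈ interior K, ∃ C : ℝ, 0 < C ∧ ∃ r₀ : ℕ,
      ∀ f : MvPolynomial (Fin n) ℝ,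
        (∀ x ∈ K, LasserreUpper.polyFun f a ≤ LasserreUpper.polyFun f x) →
        LasserreUpper.hessConst L f ≤ G →
          (∀ r : ℕ, 1 ≤ r → LasserreUpper.upperError K volume f r ≤ C / (r : ℝ) ^ 2) ∧
          (∀ r : ℕ, r₀ ≤ r → LasserreUpper.upperError K volume f r ≤ c / (r : ℝ) ^ 2) := by
  -- The `+ 1` keeps `R` positive when `K` is a point (`n = 0`).
  set R := Metric.diam K + 1 with hRdef
  have hR : 0 < R := by have := Metric.diam_nonneg (s := K); linarith
  set I := ∫ y : EuclideanSpace ℝ (Fin n), ((1 + ‖y‖ ^ 2) ^ (2 * n + 1))⁻¹ with hI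
  have hI0 : 0 ≤ I := integral_nonneg fun y => by simp only [Pi.zero_apply]; positivity
  set V := volume.real (Metric.ball (0 : EuclideanSpace ℝ (Fin n)) 1) with hVdef
  have hV : 0 < V :=
    ENNReal.toReal_pos (Metric.measure_ball_pos _ _ one_pos).ne' measure_ball_lt_top.ne
  set D := R ^ 2 * 2 ^ (2 * n + 2) * 4 ^ (2 * n + 2) * I / V with hD
  have hD0 : 0 ≤ D := by positivity
  -- `c` is fixed before any `f` shows that `G ≥ 0`, hence `|G|`.
  set c := 2 * |G| * (D * (4 * (n + 1)) ^ 2) + 1 with hc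
  have hc0 : 0 < c := by positivity
  refine ⟨c, hc0, fun a ha => ?_⟩
  have haK := interior_subset ha
  have hKR : ∀ x ∈ K, ‖x - a‖ ≤ R := fun x hx => by
    rw [← dist_eq_norm]
    linarith [Metric.dist_le_diam_of_mem hK.isBounded hx haK]
  obtain ⟨δ, hδ, hball⟩ := Metric.isOpen_iff.mp isOpen_interior a ha
  have hball' : Metric.ball a δ ⊆ K := hball.trans interior_subset
  obtain ⟨k₀, hk₀⟩ := exists_nat_gt (R / δ)
  set r₀ := 2 * (n + 1) * (k₀ + 1) with hr₀
  refine ⟨max c (2 * |G| * R ^ 2 * r₀ ^ 2), lt_max_of_lt_left hc0, r₀, fun f hmin hG => ?_⟩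
  obtain ⟨hG0, hquad⟩ := polyFun_sub_le_of_hessConst_le hL hLconv hKL ha hmin hG
  rw [abs_of_nonneg hG0] at hc ⊢
  have hlarge : ∀ r : ℕ, r₀ ≤ r → upperError K volume f r ≤ c / (r : ℝ) ^ 2 := by
    intro r hr
    set k := r / (2 * (n + 1)) with hkdef
    have hkk : k₀ + 1 ≤ k := by
      rw [hkdef, Nat.le_div_iff_mul_le (by positivity), mul_comm]
      exact hr
    have hk : 1 ≤ k := by omega
    have hk' : (0 : ℝ) < k := by exact_mod_cast hk
    have hkr : 2 * (n + 1) * k ≤ r := Nat.mul_div_le _ _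
    -- Rounding down costs at most a factor 2, since `k + 1 ≤ 2k`.
    have hrk : r ≤ 4 * (n + 1) * k := by
      have h1 := Nat.lt_mul_div_succ r (show 0 < 2 * (n + 1) by positivity)
      rw [← hkdef] at h1
      nlinarith
    have hr0 : 0 < r := lt_of_lt_of_le (by positivity) hkr
    have hkδ : R / k ≤ δ := by
      have : R / δ ≤ k := hk₀.le.trans (by exact_mod_cast (by omega : k₀ ≤ k))
      rw [div_le_iff₀ hδ] at this
      rw [div_le_iff₀ hk']
      linarith
    have hden := le_integral_needle hK hR hk ((Metric.ball_subset_ball hkδ).trans hball')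
    have hpos : 0 < ∫ x in K, polyFun (needle a R k) x := lt_of_lt_of_le (by positivity) hden
    have hB : ∫ x in K, ‖x - a‖ ^ 2 * polyFun (needle a R k) x ≤
        D / k ^ 2 * ∫ x in K, polyFun (needle a R k) x :=
      calc _ ≤ _ := integral_norm_sq_mul_needle_le hK hR hKR hk
        _ = D / k ^ 2 * ((1 / 4) ^ (2 * n + 2) * ((R / k) ^ n * V)) := by
            rw [hD, one_div, inv_pow, ← hI, pow_add (R / k)]
            field_simp
        _ ≤ _ := by gcongr
    have hE := upperError_le (r := r) hK haK hmin (by positivity) hquad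
      ⟨IsSumSq.mul_self _, (totalDegree_needle_le a R k).trans (Nat.mul_le_mul_left 2 hkr)⟩ hpos hB
    refine hE.trans ?_
    have hrk' : (r : ℝ) ≤ 4 * (n + 1) * k := by exact_mod_cast hrk
    have hr0' : (0 : ℝ) < r := by exact_mod_cast hr0
    have h1 : D / (k : ℝ) ^ 2 ≤ D * (4 * (n + 1)) ^ 2 / (r : ℝ) ^ 2 := by
      rw [div_le_div_iff₀ (by positivity) (by positivity)]
      calc D * (r : ℝ) ^ 2 ≤ D * (4 * (n + 1) * k) ^ 2 := by gcongr
        _ = _ := by ring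
    calc 2 * G * (D / k ^ 2) ≤ 2 * G * (D * (4 * (n + 1)) ^ 2 / (r : ℝ) ^ 2) := by gcongr
      _ = 2 * G * (D * (4 * (n + 1)) ^ 2) / (r : ℝ) ^ 2 := by ring
      _ ≤ _ := by gcongr; linarith
  refine ⟨fun r hr => ?_, hlarge⟩
  have hr' : (0 : ℝ) < r := by exact_mod_cast hr
  rcases le_or_gt r₀ r with h | h
  · exact (hlarge r h).trans (by gcongr; exact le_max_left _ _)
  -- For `r < r₀` the density `1` gives error at most `2 * G * R ^ 2`; the factor `r₀ ^ 2` in `C`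
  -- absorbs `r ^ 2`.
  · have hint1 : IntegrableOn (fun x => ‖x - a‖ ^ 2) K :=
      ContinuousOn.integrableOn_compact hK (Continuous.continuousOn (by fun_prop))
    have hvol : 0 < volume.real K :=
      ENNReal.toReal_pos (Measure.measure_pos_of_nonempty_interior _ hKint).ne' hK.measure_lt_top.ne
    have hone : ∀ x : EuclideanSpace ℝ (Fin n), polyFun 1 x = 1 := fun x => by simp [polyFun]
    have hE := upperError_le (r := r) (q := 1) (B := R ^ 2) hK haK hmin (by positivity) hquad
      ⟨IsSumSq.one, by simp⟩ (by simpa [hone] using hvol) (by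
        simp only [hone, mul_one, ← integral_const_mul]
        exact setIntegral_mono_on hint1 (integrableOn_const hK.measure_lt_top.ne)
          hK.measurableSet fun x hx => pow_le_pow_left₀ (norm_nonneg _) (hKR x hx) 2)
    refine hE.trans ?_
    have h2 : (r : ℝ) ≤ r₀ := by exact_mod_cast h.le
    rw [le_div_iff₀ (by positivity)]
    refine le_trans ?_ (le_max_right _ _)
    gcongr
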